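/- Let $k\ge 1$ be an integer and $N=2k$. Let $\mathbb{H}^N$ be hyperbolic $N$-space in the ball model, i.e. the open unit ball $\mathbb{B}^N\subset\mathbb{R}^N$ with the metric $g=\left(\frac{2}{1-|x|^2}\right)^2\sum_i dx_i^2$, with volume element $dv_g$, gradient $\nabla_g$ and Laplace-Beltrami operator $\Delta_g$. Let $$P_1=-\Delta_g-\frac{N(N-2)}{4},\qquad P_k=P_1(P_1+2)(P_1+6)\cdots(P_1+k(k-1))$$ be the conformal Laplacian and the critical GJMS operator of $\mathbb{H}^N$. Let $H^k(\mathbb{H}^N)$ be the completion of $C_c^\infty(\mathbb{H}^N)$, regarded as a space of functions in $L^2(\mathbb{H}^N)$, with respect to the norm $$\|u\|=\Big[\sum_{m=0}^k\int_{\mathbb{H}^N}|\nabla_g^m u|_g^2\,dv_g\Big]^{1/2},\qquad \nabla_g^m=\Delta_g^{m/2}\ (m\text{ even}),\quad \nabla_g^m=\nabla_g\Delta_g^{(m-1)/2}\ (m\text{ odd}).$$ Let $Q_1,Q_2$ be real-valued functions on $\mathbb{H}^N$ such that $Q_2\in L^1_{\mathrm{loc}}(\mathbb{H}^N)$, $Q_1-Q_2\in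 L^2(\mathbb{H}^N)$ and $Q_2\le 0$ almost everywhere. Then the equation $$P_k(u)+Q_1=Q_2e^{2u}$$ has a weak solution $u\in H^k(\mathbb{H}^N)$: the function $Q_2e^{2u}$ is locally integrable, and $$\int_{\mathbb{H}^N}u\,P_kv\,dv_g+\int_{\mathbb{H}^N}Q_1v\,dv_g=\int_{\mathbb{H}^N}Q_2e^{2u}v\,dv_g\qquad\text{for all }v\in C_c^\infty(\mathbb{H}^N).$$ -/

import Mathlib

open MeasureTheory Filter Topology Metric
open scoped ContDiff

noncomputable section

namespace Hyp

/-- The coordinate space `ℝ^N` with its Euclidean norm. Hyperbolic `N`-space is the open unit ball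
`𝔹^N ⊆ ℝ^N` with the Poincaré metric `g = (2 / (1 - |x|²))² ∑ dx_i²`. A function on hyperbolic space
is represented by a function on `ℝ^N`, of which only the values on the ball matter. -/
abbrev E (N : ℕ) : Type := EuclideanSpace ℝ (Fin N)

/-- The open unit ball `𝔹^N`, the underlying set of hyperbolic space. -/
def unitBall (N : ℕ) : Set (E N) := ball 0 1

/-- The hyperbolic volume `dv_g = (2 / (1 - |x|²))^N dx` on the unit ball. -/
def vol (N : ℕ) : Measure (E N) :=
  (volume.restrict (unitBall N)).withDensity
    (fun x => ENNReal.ofReal ((2 / (1 - ‖x‖ ^ 2)) ^ N))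

/-- The reciprocal conformal factor `(1 - |x|²) / 2`. -/
def invFactor {N : ℕ} (x : E N) : ℝ := (1 - ‖x‖ ^ 2) / 2

/-- The Laplace-Beltrami operator of the Poincaré metric,
`Δ_g = ((1 - |x|²) / 2)² Δ + (N - 2) ((1 - |x|²) / 2) ⟨x, ∇⟩`. -/
def lap {N : ℕ} (u : E N → ℝ) : E N → ℝ := fun x =>
  invFactor x ^ 2 * Laplacian.laplacian u x
    + ((N : ℝ) - 2) * invFactor x * inner ℝ x (gradient u x)

/-- `|∇_g^m u|_g²`, where `∇_g^m = Δ_g^{m/2}` for even `m` and `∇_g^m = ∇_g Δ_g^{(m-1)/2}` for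
odd `m`; here `∇_g = ((1 - |x|²) / 2)² ∇`, so that `|∇_g w|_g² = ((1 - |x|²) / 2)² |∇ w|²`. -/
def gradNormSq {N : ℕ} (m : ℕ) (u : E N → ℝ) (x : E N) : ℝ :=
  if Even m then (lap^[m / 2] u x) ^ 2
  else invFactor x ^ 2 * ‖gradient (lap^[(m - 1) / 2] u) x‖ ^ 2

/-- The norm `(∑_{m=0}^k ∫ |∇_g^m u|_g² dv_g)^{1/2}` (used for test functions only). -/
def sobolevNorm {N : ℕ} (k : ℕ) (u : E N → ℝ) : ℝ :=
  Real.sqrt (∑ m ∈ Finset.range (k + 1), ∫ x, gradNormSq m u x ∂(vol N))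

/-- `φ ∈ C_c^∞(ℍ^N)`: smooth, with compact support contained in the open unit ball. -/
structure IsTest {N : ℕ} (φ : E N → ℝ) : Prop where
  smooth : ContDiff ℝ ∞ φ
  compact : HasCompactSupport φ
  subset : tsupport φ ⊆ unitBall N

/-- `u ∈ H^k(ℍ^N)`, the completion of `C_c^∞(ℍ^N)` in the norm `sobolevNorm k`, realised as a space
of functions in `L²(ℍ^N)`: since the norm dominates the `L²` norm, a Cauchy sequence of test functions
has an `L²` limit, and `u ∈ H^k(ℍ^N)` when `u` is such a limit. -/
def MemH {N : ℕ} (k : ℕ) (u : E N → ℝ) : Prop :=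
  MemLp u 2 (vol N) ∧
  ∃ φ : ℕ → E N → ℝ, (∀ n, IsTest (φ n)) ∧
    (∀ ε : ℝ, 0 < ε → ∃ n₀ : ℕ, ∀ m n : ℕ, n₀ ≤ m → n₀ ≤ n → sobolevNorm k (φ m - φ n) < ε) ∧
    Tendsto (fun n => eLpNorm (φ n - u) 2 (vol N)) atTop (𝓝 0)

/-- The scalar curvature `-N (N - 1)` of hyperbolic `N`-space. -/
def scalarCurvature (N : ℕ) : ℝ := -((N : ℝ) * ((N : ℝ) - 1))

/-- The conformal Laplacian `P_1 = -Δ_g + (N - 2) / (4 (N - 1)) R_g` of hyperbolic space. -/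
def yamabe {N : ℕ} (u : E N → ℝ) : E N → ℝ := fun x =>
  -lap u x + ((N : ℝ) - 2) / (4 * ((N : ℝ) - 1)) * scalarCurvature N * u x

/-- The GJMS operator of order `2k` on hyperbolic space,
`P_k = P_1 (P_1 + 2) (P_1 + 6) ⋯ (P_1 + k (k - 1))`; the innermost factor comes last. -/
def gjms {N : ℕ} : ℕ → (E N → ℝ) → (E N → ℝ)
  | 0, u => u
  | k + 1, u => gjms k (fun x => yamabe u x + ((k : ℝ) + 1) * (k : ℝ) * u x)

/-- `u` solves `P_k u + Q₁ = Q₂ e^{2u}` on hyperbolic space in the weak sense: the right-hand side is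
locally integrable and the equation holds when tested against every `v ∈ C_c^∞(ℍ^N)`. As `P_k` is
formally self-adjoint with respect to `dv_g`, the pairing of `P_k u` with `v` is `∫ u (P_k v) dv_g`. -/
def IsWeakSolution {N : ℕ} (k : ℕ) (Q₁ Q₂ u : E N → ℝ) : Prop :=
  LocallyIntegrableOn (fun x => Q₂ x * Real.exp (2 * u x)) (unitBall N) (vol N) ∧
  ∀ v : E N → ℝ, IsTest v →
    ∫ x, u x * gjms k v x ∂(vol N) + ∫ x, Q₁ x * v x ∂(vol N)
      = ∫ x, Q₂ x * Real.exp (2 * u x) * v x ∂(vol N)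

end Hyp

end

/-!
The equation is the Euler-Lagrange equation of the convex functional
`J(u) = ½ ∫ u P_k u + ∫ (Q₁ - Q₂) u + ½ ∫ (-Q₂) (e^{2u} - 1 - 2u)`, whose last integrand is nonnegative
because `Q₂ ≤ 0`; the solution is the minimiser of `J` over `H^k`.

*Coercivity.* On test functions `A = P_1` is symmetric for `L²(dv_g)` (Green's formula,
`integral_lap_mul`), and `⟨A u, u⟩ ≥ ¼ ⟨u, u⟩` (`poincare`, the inequality
`∫ |∇_g u|² ≥ (N - 1)² / 4 ∫ u²`, which comes from the ground state `(1 - |x|²)^{(N - 1) / 2}`). A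
symmetric operator with such a gap satisfies `¼ ⟨A^n u, u⟩ ≤ ⟨A^{n+1} u, u⟩` for all `n`
(`form_pow_succ_ge`). As `P_k = ∏_{j < k} (A + j (j + 1))` and `-Δ_g = A + N (N - 2) / 4` are polynomials
in `A` with nonnegative coefficients, `⟨P_k u, u⟩` dominates `⟨A^k u, u⟩`, which in turn dominates every
`∫ |∇_g^m u|² = ⟨(-Δ_g)^m u, u⟩` with `m ≤ k`. No spectral theory is needed.

*Minimisation.* The form `⟨P_k u, v⟩` makes the test functions a pre-Hilbert space whose completion maps
continuously to `L²`. On it `J` is, up to a translation, half the squared norm plus a convex lower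
semicontinuous functional (Fatou), so that a minimising sequence is Cauchy by the parallelogram law
(`exists_minimiser`). `J` may be infinite, but at a minimiser `u` the function `Q₂ e^{2u}` is integrable
on compact sets, so `J` stays finite along `u + t v` for test functions `v`, and comparing the values at
`t` and `0` to first order in `t` gives the equation (`exists_eulerLagrange`). Minimising over the whole
completion, rather than over test functions, is what makes `u + t v` an admissible competitor.
-/

namespace Hyp

/-! ### Symmetric operators with a gap, and polynomials in them -/

section Algebra

variable {V : Type*} [AddCommGroup V] [Module ℝ V]

/-- The product `∏_{j < k} (A + j (j + 1))`, built in the order in which `gjms` composes its factors. -/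
noncomputable def prodShift (A : Module.End ℝ V) : ℕ → Module.End ℝ V
  | 0 => 1
  | k + 1 => prodShift A k * (A + (((k : ℝ) + 1) * (k : ℝ)) • 1)

lemma commute_prodShift (A : Module.End ℝ V) (k : ℕ) : Commute A (prodShift A k) := by
  induction k with
  | zero => exact Commute.one_right A
  | succ k ih =>
    exact ih.mul_right ((Commute.refl A).add_right ((Commute.one_right A).smul_right _))

variable {B : LinearMap.BilinForm ℝ V} {A : Module.End ℝ V} {δ : ℝ}

lemma form_pow_symm (hA : ∀ u v, B (A u) v = B u (A v)) (n : ℕ) (u v : V) :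
    B ((A ^ n) u) v = B u ((A ^ n) v) := by
  induction n generalizing u v with
  | zero => simp
  | succ n ih =>
    rw [pow_succ, Module.End.mul_apply, ih, hA, ← Module.End.mul_apply, ← pow_succ', pow_succ]

lemma form_neg_pow_two_mul (hA : ∀ u v, B (A u) v = B u (A v)) (j : ℕ) (u : V) :
    B (((-A) ^ (2 * j)) u) u = B ((A ^ j) u) ((A ^ j) u) := by
  rw [(even_two_mul j).neg_pow, form_pow_symm hA j, ← Module.End.mul_apply, ← pow_add, ← two_mul,
    form_pow_symm hA]

lemma form_neg_pow_two_mul_add_one (hA : ∀ u v, B (A u) v = B u (A v)) (j : ℕ) (u : V) :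
    B (((-A) ^ (2 * j + 1)) u) u = -B (A ((A ^ j) u)) ((A ^ j) u) := by
  rw [(odd_two_mul_add_one j).neg_pow, LinearMap.neg_apply, map_neg, LinearMap.neg_apply,
    ← form_pow_symm hA j, ← Module.End.mul_apply, ← Module.End.mul_apply, ← pow_succ, ← pow_add]
  ring_nf

lemma form_prodShift_symm (hA : ∀ u v, B (A u) v = B u (A v)) (k : ℕ) (u v : V) :
    B (prodShift A k u) v = B u (prodShift A k v) := by
  induction k generalizing u v with
  | zero => simp [prodShift]
  | succ k ih =>
    have hc : Commute (prodShift A k) (A + (((k : ℝ) + 1) * (k : ℝ)) • (1 : Module.End ℝ V)) :=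
      (commute_prodShift A k).symm.add_right ((Commute.one_right _).smul_right _)
    have h1 : prodShift A (k + 1)
        = (A + (((k : ℝ) + 1) * (k : ℝ)) • (1 : Module.End ℝ V)) * prodShift A k := hc.eq
    rw [show prodShift A (k + 1) v = _ from congrArg (· v) h1]
    simp [prodShift, ih, hA]

/-- For even `n = 2i` this is the gap inequality at `A^i u`; for odd `n = 2i + 1` it is
`δ ⟨A w, w⟩ ≤ ⟨A w, A w⟩` with `w = A^i u`, which follows from `⟨A w - δ w, A w - δ w⟩ ≥ 0`. -/
lemma form_pow_succ_ge (hs : ∀ u v, B u v = B v u) (h0 : ∀ u, 0 ≤ B u u)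
    (hA : ∀ u v, B (A u) v = B u (A v)) (hδ : 0 ≤ δ) (hgap : ∀ u, δ * B u u ≤ B (A u) u)
    (n : ℕ) (u : V) : δ * B ((A ^ n) u) u ≤ B ((A ^ (n + 1)) u) u := by
  obtain ⟨i, rfl | rfl⟩ := Nat.even_or_odd' n
  · have h := hgap ((A ^ i) u)
    rw [← Module.End.mul_apply, ← pow_succ', form_pow_symm hA, form_pow_symm hA,
      ← Module.End.mul_apply, ← Module.End.mul_apply, ← pow_add, ← pow_add] at h
    rw [form_pow_symm hA, form_pow_symm hA (2 * i + 1)]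
    convert h using 4 <;> ring_nf
  · set w := (A ^ i) u with hw
    have e1 : B ((A ^ (2 * i + 1)) u) u = B (A w) w := by
      rw [form_pow_symm hA, hw, ← Module.End.mul_apply, ← pow_succ', form_pow_symm hA,
        ← Module.End.mul_apply, ← pow_add]
      ring_nf
    have e2 : B ((A ^ (2 * i + 1 + 1)) u) u = B (A w) (A w) := by
      rw [form_pow_symm hA, hw, ← Module.End.mul_apply, ← pow_succ', form_pow_symm hA,
        ← Module.End.mul_apply, ← pow_add]
      ring_nf
    rw [e1, e2]
    have h1 := h0 (A w - δ • w)
    have h2 := mul_le_mul_of_nonneg_left (hgap w) hδ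
    simp only [map_sub, LinearMap.sub_apply, map_smul, LinearMap.smul_apply, smul_eq_mul,
      hs w (A w)] at h1
    nlinarith

lemma form_pow_nonneg (hs : ∀ u v, B u v = B v u) (h0 : ∀ u, 0 ≤ B u u)
    (hA : ∀ u v, B (A u) v = B u (A v)) (hδ : 0 ≤ δ) (hgap : ∀ u, δ * B u u ≤ B (A u) u)
    (n : ℕ) (u : V) : 0 ≤ B ((A ^ n) u) u := by
  induction n with
  | zero => simpa using h0 u
  | succ n ih => exact (mul_nonneg hδ ih).trans (form_pow_succ_ge hs h0 hA hδ hgap n u)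

lemma form_pow_le (hs : ∀ u v, B u v = B v u) (h0 : ∀ u, 0 ≤ B u u)
    (hA : ∀ u v, B (A u) v = B u (A v)) (hδ : 0 ≤ δ) (hgap : ∀ u, δ * B u u ≤ B (A u) u)
    (m j : ℕ) (u : V) : δ ^ j * B ((A ^ m) u) u ≤ B ((A ^ (m + j)) u) u := by
  induction j with
  | zero => simp
  | succ j ih =>
    calc _ = δ * (δ ^ j * B ((A ^ m) u) u) := by ring
      _ ≤ δ * B ((A ^ (m + j)) u) u := mul_le_mul_of_nonneg_left ih hδ
      _ ≤ _ := form_pow_succ_ge hs h0 hA hδ hgap _ u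

/-- Expanding the product, all terms besides `A^{m + k}` contribute nonnegatively. The extra power `A^m`
lets the induction absorb one factor at a time. -/
lemma form_pow_le_form_prodShift (hs : ∀ u v, B u v = B v u) (h0 : ∀ u, 0 ≤ B u u)
    (hA : ∀ u v, B (A u) v = B u (A v)) (hδ : 0 ≤ δ) (hgap : ∀ u, δ * B u u ≤ B (A u) u)
    (k m : ℕ) (u : V) :
    B ((A ^ (m + k)) u) u ≤ B ((A ^ m * prodShift A k) u) u := by
  induction k generalizing m with
  | zero => simp [prodShift]
  | succ k ih =>
    have e : A ^ m * prodShift A (k + 1) = A ^ (m + 1) * prodShift A k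
        + (((k : ℝ) + 1) * (k : ℝ)) • (A ^ m * prodShift A k) := by
      rw [prodShift, mul_add, mul_add, ← (commute_prodShift A k).eq, ← mul_assoc, ← pow_succ,
        mul_smul_comm, mul_smul_comm, mul_one]
    rw [e]
    simp only [LinearMap.add_apply, LinearMap.smul_apply, map_add, map_smul, smul_eq_mul]
    have h1 := ih (m + 1)
    have h2 := (form_pow_nonneg hs h0 hA hδ hgap (m + k) u).trans (ih m)
    have h3 : 0 ≤ ((k : ℝ) + 1) * (k : ℝ) * B ((A ^ m * prodShift A k) u) u := by positivity
    rw [show m + (k + 1) = m + 1 + k by ring]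
    linarith

/-- Lower powers of `A` are absorbed in higher ones by the gap inequality, each factor `A + c` at the
price of `1 + c / δ`. -/
lemma form_shift_pow_le (hs : ∀ u v, B u v = B v u) (h0 : ∀ u, 0 ≤ B u u)
    (hA : ∀ u v, B (A u) v = B u (A v)) (hδ : 0 < δ) (hgap : ∀ u, δ * B u u ≤ B (A u) u)
    {c : ℝ} (hc : 0 ≤ c) (j m : ℕ) (u : V) :
    B ((A ^ m * (A + c • 1) ^ j) u) u ≤ (1 + c / δ) ^ j * B ((A ^ (m + j)) u) u := by
  induction j generalizing m with
  | zero => simp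
  | succ j ih =>
    have hcomm : Commute A ((A + c • (1 : Module.End ℝ V)) ^ j) :=
      ((Commute.refl A).add_right ((Commute.one_right A).smul_right _)).pow_right j
    have e : A ^ m * (A + c • (1 : Module.End ℝ V)) ^ (j + 1)
        = A ^ (m + 1) * (A + c • 1) ^ j + c • (A ^ m * (A + c • 1) ^ j) := by
      rw [pow_succ (A + c • 1), mul_add, mul_add, ← hcomm.eq, ← mul_assoc, ← pow_succ,
        mul_smul_comm, mul_smul_comm, mul_one]
    rw [e]
    simp only [LinearMap.add_apply, LinearMap.smul_apply, map_add, map_smul, smul_eq_mul]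
    have h1 := ih (m + 1)
    have h2 := mul_le_mul_of_nonneg_left (ih m) hc
    have h3 := form_pow_succ_ge hs h0 hA hδ.le hgap (m + j) u
    have h4 : 0 ≤ (1 + c / δ) ^ j * (c / δ) := by positivity
    have h5 := mul_le_mul_of_nonneg_left h3 h4
    rw [show m + 1 + j = m + j + 1 by ring] at h1
    rw [show m + (j + 1) = m + j + 1 by ring, pow_succ (1 + c / δ)]
    have h6 : (1 + c / δ) ^ j * (c / δ) * (δ * B ((A ^ (m + j)) u) u)
      = c * ((1 + c / δ) ^ j * B ((A ^ (m + j)) u) u) := by field_simp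
    rw [h6] at h5
    linarith

end Algebra

/-! ### The direct method and the Euler-Lagrange equation -/

section Minimise

variable {H : Type*} [NormedAddCommGroup H] [InnerProductSpace ℝ H]

/-- Half the squared norm plus a proper, midpoint convex, lower semicontinuous functional attains its
minimum on a Hilbert space. -/
lemma exists_minimiser [CompleteSpace H] {G : H → ENNReal} (hlsc : LowerSemicontinuous G)
    (hmid : ∀ x y, G ((1 / 2 : ℝ) • (x + y)) ≤ (G x + G y) / 2) (hne : ∃ y, G y ≠ ⊤) :
    ∃ h, G h ≠ ⊤ ∧ ∀ y, G y ≠ ⊤ →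
      ‖h‖ ^ 2 / 2 + (G h).toReal ≤ ‖y‖ ^ 2 / 2 + (G y).toReal := by
  set F : H → ℝ := fun y => ‖y‖ ^ 2 / 2 + (G y).toReal with hF
  set D : Set H := {y | G y ≠ ⊤} with hD
  have hbdd : BddBelow (F '' D) := by
    refine ⟨0, ?_⟩
    rintro _ ⟨y, -, rfl⟩
    simp only [hF]; positivity
  set m := sInf (F '' D) with hm
  have hmle : ∀ y ∈ D, m ≤ F y := fun y hy => csInf_le hbdd ⟨y, hy, rfl⟩
  have hseq : ∀ n : ℕ, ∃ y ∈ D, F y < m + 1 / ((n : ℝ) + 1) := by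
    intro n
    obtain ⟨_, ⟨y, hy, rfl⟩, h⟩ := exists_lt_of_csInf_lt
      (s := F '' D) (b := m + 1 / ((n : ℝ) + 1)) (Set.Nonempty.image F hne)
      (lt_add_of_pos_right _ (by positivity))
    exact ⟨y, hy, h⟩
  choose y hyD hyF using hseq
  -- The parallelogram law: the value at the midpoint falls short of the mean value by at least
  -- `‖a - b‖² / 8`, and it is at least the infimum `m`.
  have hdist : ∀ a ∈ D, ∀ b ∈ D, ‖a - b‖ ^ 2 ≤ 4 * (F a + F b - 2 * m) := by
    intro a ha b hb
    have hfin : (G a + G b) / 2 ≠ ⊤ :=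
      ENNReal.div_ne_top (ENNReal.add_ne_top.2 ⟨ha, hb⟩) (by norm_num)
    have hc : (1 / 2 : ℝ) • (a + b) ∈ D := ne_top_of_le_ne_top hfin (hmid a b)
    have h1 := hmle _ hc
    have h2 := ENNReal.toReal_mono hfin (hmid a b)
    rw [ENNReal.toReal_div, ENNReal.toReal_add ha hb] at h2
    have h3 := parallelogram_law_with_norm ℝ a b
    have h4 : ‖(1 / 2 : ℝ) • (a + b)‖ ^ 2 = ‖a + b‖ ^ 2 / 4 := by
      rw [norm_smul, mul_pow]; norm_num; ring
    simp only [hF, h4] at h1 ⊢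
    simp only [ENNReal.toReal_ofNat] at h2
    nlinarith
  have hcauchy : CauchySeq y := by
    have hlim : Tendsto (fun n : ℕ => Real.sqrt (8 * (1 / ((n : ℝ) + 1)))) atTop (𝓝 0) := by
      have := (tendsto_one_div_add_atTop_nhds_zero_nat (𝕜 := ℝ)).const_mul 8
      rw [mul_zero] at this
      simpa only [Real.sqrt_zero, Function.comp_def] using
        (Real.continuous_sqrt.tendsto 0).comp this
    refine cauchySeq_of_le_tendsto_0 _ (fun n p N hn hp => ?_) hlim
    rw [dist_eq_norm]
    apply Real.le_sqrt_of_sq_le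
    have e1 : 1 / ((n : ℝ) + 1) ≤ 1 / ((N : ℝ) + 1) := Nat.one_div_le_one_div hn
    have e2 : 1 / ((p : ℝ) + 1) ≤ 1 / ((N : ℝ) + 1) := Nat.one_div_le_one_div hp
    have := hdist _ (hyD n) _ (hyD p)
    linarith [hyF n, hyF p]
  obtain ⟨h, hh⟩ := cauchySeq_tendsto_of_complete hcauchy
  have hnorm : Tendsto (fun n : ℕ => m + 1 / ((n : ℝ) + 1) - ‖y n‖ ^ 2 / 2) atTop
      (𝓝 (m + 0 - ‖h‖ ^ 2 / 2)) :=
    (tendsto_const_nhds.add tendsto_one_div_add_atTop_nhds_zero_nat).sub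
      ((hh.norm.pow 2).div_const 2)
  rw [add_zero] at hnorm
  have hG : ∀ n : ℕ, (G (y n)).toReal ≤ m + 1 / ((n : ℝ) + 1) - ‖y n‖ ^ 2 / 2 := fun n => by
    have := hyF n
    simp only [hF] at this
    linarith
  have hpos : 0 ≤ m - ‖h‖ ^ 2 / 2 :=
    ge_of_tendsto' hnorm fun n => ENNReal.toReal_nonneg.trans (hG n)
  -- Along the minimising sequence `G` is at most `m + 1 / (n + 1) - ‖y n‖² / 2`; lower semicontinuity
  -- passes this bound to the limit.
  have hGh : G h ≤ ENNReal.ofReal (m - ‖h‖ ^ 2 / 2) := by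
    refine le_of_forall_lt_imp_le_of_dense fun c hc => ?_
    refine ge_of_tendsto ((ENNReal.continuous_ofReal.tendsto _).comp hnorm) ?_
    filter_upwards [hh.eventually (hlsc h c hc)] with n hn
    exact hn.le.trans (ENNReal.le_ofReal_iff_toReal_le (hyD n)
      (ENNReal.toReal_nonneg.trans (hG n)) |>.2 (hG n))
  have hfin : G h ≠ ⊤ := ne_top_of_le_ne_top ENNReal.ofReal_ne_top hGh
  refine ⟨h, hfin, fun z hz => ?_⟩
  have h1 := ENNReal.toReal_le_of_le_ofReal hpos hGh
  have h2 := hmle z hz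
  simp only [hF] at h2
  linarith

end Minimise

section EulerLagrange

/-- `(e^{2s} - 1 - 2s) / 2`, half the gap between `e^{2s}` and its tangent at `0`; its derivative is
`e^{2s} - 1`. -/
noncomputable def expGap (s : ℝ) : ℝ := (Real.exp (2 * s) - 1 - 2 * s) / 2

lemma continuous_expGap : Continuous expGap := by
  unfold expGap; fun_prop

lemma expGap_nonneg (s : ℝ) : 0 ≤ expGap s := by
  unfold expGap
  linarith [Real.add_one_le_exp (2 * s)]

/-- This bounds `∫ q e^{2u}` over a set where `q` is integrable by `∫ q expGap(u)`. -/
lemma exp_le_expGap (s : ℝ) : Real.exp (2 * s) ≤ 4 * expGap s + 2 := by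
  -- `½ e^{2s} = e^{2s - log 2} ≥ 1 + 2s - log 2`, and `log 2 ≤ 1`.
  have h := Real.add_one_le_exp (2 * s - Real.log 2)
  rw [Real.exp_sub, Real.exp_log two_pos] at h
  have h2 := Real.log_two_lt_d9
  unfold expGap
  linarith

lemma convexOn_expGap : ConvexOn ℝ Set.univ expGap := by
  have h1 : ConvexOn ℝ Set.univ (fun s : ℝ => Real.exp (2 * s)) :=
    convexOn_exp.comp_linearMap (LinearMap.mulLeft ℝ (2 : ℝ))
  refine ⟨convex_univ, fun x _ y _ a b ha hb hab => ?_⟩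
  have h := h1.2 (Set.mem_univ x) (Set.mem_univ y) ha hb hab
  simp only [smul_eq_mul] at h ⊢
  unfold expGap
  linear_combination h / 2 + hab / 2

lemma exp_sub_one_sub_le (z : ℝ) : Real.exp z - 1 - z ≤ z ^ 2 * Real.exp |z| := by
  rcases le_total 0 z with hz | hz
  · rw [abs_of_nonneg hz]
    have h := Real.add_one_le_exp (-z)
    have h1 : Real.exp z - 1 ≤ z * Real.exp z := by
      have h2 := mul_le_mul_of_nonneg_left h (Real.exp_pos z).le
      rw [← Real.exp_add, add_neg_cancel, Real.exp_zero] at h2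
      linarith
    nlinarith
  · have h := Real.add_one_le_exp (-z)
    have h1 : Real.exp z - 1 ≤ z * Real.exp z := by
      have h2 := mul_le_mul_of_nonneg_left h (Real.exp_pos z).le
      rw [← Real.exp_add, add_neg_cancel, Real.exp_zero] at h2
      linarith
    have h3 := Real.add_one_le_exp z
    have h4 : 1 ≤ Real.exp |z| := Real.one_le_exp (abs_nonneg z)
    nlinarith [sq_nonneg z]

/-- First-order expansion of `expGap` with a remainder that is integrable whenever `e^{2s}` is. -/
lemma expGap_add_le {M t d : ℝ} (s : ℝ) (ht0 : 0 ≤ t) (ht1 : t ≤ 1) (hd : |d| ≤ M) :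
    expGap (s + t * d) ≤ expGap s + t * ((Real.exp (2 * s) - 1) * d)
      + t ^ 2 * (2 * M ^ 2 * Real.exp (2 * M) * Real.exp (2 * s)) := by
  have h := exp_sub_one_sub_le (2 * (t * d))
  have habs : |2 * (t * d)| ≤ 2 * M := by
    rw [abs_mul, abs_mul, abs_of_nonneg ht0, abs_two]
    nlinarith [abs_nonneg d]
  have h1 : Real.exp |2 * (t * d)| ≤ Real.exp (2 * M) := Real.exp_le_exp.2 habs
  have h2 : d ^ 2 ≤ M ^ 2 := sq_le_sq' (by linarith [neg_abs_le d]) ((le_abs_self d).trans hd)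
  have h3 : (2 * (t * d)) ^ 2 * Real.exp |2 * (t * d)| ≤ 4 * t ^ 2 * (M ^ 2 * Real.exp (2 * M)) := by
    rw [show (2 * (t * d)) ^ 2 * Real.exp |2 * (t * d)|
      = 4 * t ^ 2 * (d ^ 2 * Real.exp |2 * (t * d)|) by ring]
    gcongr
  have h4 := mul_le_mul_of_nonneg_left (h.trans h3) (Real.exp_pos (2 * s)).le
  unfold expGap
  rw [show 2 * (s + t * d) = 2 * s + 2 * (t * d) by ring, Real.exp_add]
  linarith

variable {α : Type*} [MeasurableSpace α] {μ : Measure α}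

/-- The convex energy `∫ q (e^{2w} - 1 - 2w) / 2 dμ` of `w ∈ L²`, possibly infinite. -/
noncomputable def expEnergy (μ : Measure α) (q : α → ℝ) (w : Lp ℝ 2 μ) : ENNReal :=
  ∫⁻ x, ENNReal.ofReal (q x * expGap (w x)) ∂μ

lemma aestronglyMeasurable_mul_expGap {q : α → ℝ} (hq : AEStronglyMeasurable q μ)
    (w : Lp ℝ 2 μ) : AEStronglyMeasurable (fun x => q x * expGap (w x)) μ :=
  hq.mul (continuous_expGap.comp_aestronglyMeasurable (Lp.aestronglyMeasurable w))

lemma lowerSemicontinuous_expEnergy {q : α → ℝ} (hq : AEStronglyMeasurable q μ) :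
    LowerSemicontinuous (expEnergy μ q) := by
  rw [lowerSemicontinuous_iff_isClosed_preimage]
  intro c
  refine IsSeqClosed.isClosed fun w w₀ hw hlim => ?_
  obtain ⟨ns, -, hae⟩ := (tendstoInMeasure_of_tendsto_Lp hlim).exists_seq_tendsto_ae
  have h1 : expEnergy μ q w₀
      = ∫⁻ x, liminf (fun n => ENNReal.ofReal (q x * expGap (w (ns n) x))) atTop ∂μ := by
    refine lintegral_congr_ae ?_
    filter_upwards [hae] with x hx
    refine (Tendsto.liminf_eq ?_).symm
    exact (ENNReal.continuous_ofReal.tendsto _).comp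
      (((continuous_expGap.tendsto _).comp hx).const_mul (q x))
  rw [Set.mem_preimage, Set.mem_Iic, h1]
  refine (lintegral_liminf_le' fun n =>
    (aestronglyMeasurable_mul_expGap hq _).aemeasurable.ennreal_ofReal).trans ?_
  refine liminf_le_of_frequently_le' (Eventually.frequently (Eventually.of_forall fun n => ?_))
  exact hw (ns n)

lemma expEnergy_midpoint_le {q : α → ℝ} (hq : AEStronglyMeasurable q μ) (hq0 : 0 ≤ᵐ[μ] q)
    (v w : Lp ℝ 2 μ) :
    expEnergy μ q ((1 / 2 : ℝ) • (v + w)) ≤ (expEnergy μ q v + expEnergy μ q w) / 2 := by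
  have hm := fun w => (aestronglyMeasurable_mul_expGap hq w).aemeasurable.ennreal_ofReal
  unfold expEnergy
  rw [← lintegral_add_left' (hm v), ENNReal.div_eq_inv_mul,
    ← lintegral_const_mul' _ _ (by norm_num)]
  refine lintegral_mono_ae ?_
  filter_upwards [hq0, Lp.coeFn_smul (1 / 2 : ℝ) (v + w), Lp.coeFn_add v w] with x hx h1 h2
  have hx' : 0 ≤ q x := hx
  rw [h1, Pi.smul_apply, h2, Pi.add_apply, ← ENNReal.ofReal_add
    (mul_nonneg hx' (expGap_nonneg _)) (mul_nonneg hx' (expGap_nonneg _)),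
    show (2 : ENNReal)⁻¹ = ENNReal.ofReal (1 / 2) by
      rw [one_div, ENNReal.ofReal_inv_of_pos two_pos]; simp,
    ← ENNReal.ofReal_mul (by norm_num)]
  refine ENNReal.ofReal_le_ofReal ?_
  have h := convexOn_expGap.2 (Set.mem_univ (v x)) (Set.mem_univ (w x))
    (by norm_num : (0 : ℝ) ≤ 1 / 2) (by norm_num : (0 : ℝ) ≤ 1 / 2) (by norm_num)
  rw [← smul_add] at h
  refine (mul_le_mul_of_nonneg_left h hx').trans (le_of_eq ?_)
  simp only [smul_eq_mul]
  ring

lemma integrable_of_expEnergy_ne_top {q : α → ℝ} (hq : AEStronglyMeasurable q μ)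
    (hq0 : 0 ≤ᵐ[μ] q) {w : Lp ℝ 2 μ} (hw : expEnergy μ q w ≠ ⊤) :
    Integrable (fun x => q x * expGap (w x)) μ := by
  refine (lintegral_ofReal_ne_top_iff_integrable (aestronglyMeasurable_mul_expGap hq w) ?_).1 hw
  filter_upwards [hq0] with x hx using mul_nonneg hx (expGap_nonneg _)

lemma toReal_expEnergy {q : α → ℝ} (hq : AEStronglyMeasurable q μ) (hq0 : 0 ≤ᵐ[μ] q)
    (w : Lp ℝ 2 μ) : (expEnergy μ q w).toReal = ∫ x, q x * expGap (w x) ∂μ := by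
  refine (integral_eq_lintegral_of_nonneg_ae ?_ (aestronglyMeasurable_mul_expGap hq w)).symm
  filter_upwards [hq0] with x hx using mul_nonneg hx (expGap_nonneg _)

lemma integrableOn_mul_exp {q u : α → ℝ} (hq0 : 0 ≤ᵐ[μ] q)
    (hu : AEStronglyMeasurable u μ) (hqu : Integrable (fun x => q x * expGap (u x)) μ)
    {S : Set α} (hS : IntegrableOn q S μ) :
    IntegrableOn (fun x => q x * Real.exp (2 * u x)) S μ := by
  refine Integrable.mono' ((hqu.integrableOn.const_mul 4).add (hS.const_mul 2))
    (hS.aestronglyMeasurable.mul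
      ((by fun_prop : Continuous fun s : ℝ => Real.exp (2 * s)).comp_aestronglyMeasurable
        hu.restrict)) ?_
  filter_upwards [ae_restrict_of_ae hq0] with x hx
  have hx' : 0 ≤ q x := hx
  rw [Real.norm_of_nonneg (by positivity)]
  have := mul_le_mul_of_nonneg_left (exp_le_expGap (u x)) hx'
  simp only [Pi.add_apply]
  linarith

/-- A minimiser `h` of `½ ‖h‖² + ⟨g, T h⟩ + ∫ q expGap(T h)` satisfies the Euler-Lagrange equation in every
direction `v` for which `T v` is bounded and supported in a set on which `q` is integrable. In such
directions the functional stays finite. -/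
theorem exists_eulerLagrange {H : Type*} [NormedAddCommGroup H] [InnerProductSpace ℝ H]
    [CompleteSpace H] (T : H →L[ℝ] Lp ℝ 2 μ) (g : Lp ℝ 2 μ) {q : α → ℝ}
    (hq : AEStronglyMeasurable q μ) (hq0 : 0 ≤ᵐ[μ] q) :
    ∃ h : H, Integrable (fun x => q x * expGap (T h x)) μ ∧
      ∀ (v : H) (S : Set α) (M : ℝ), MeasurableSet S → IntegrableOn q S μ →
        (∀ᵐ x ∂μ, |T v x| ≤ M) → (∀ᵐ x ∂μ, x ∉ S → T v x = 0) →
        inner ℝ h v + inner ℝ g (T v) + ∫ x, q x * (Real.exp (2 * T h x) - 1) * T v x ∂μ = 0 := by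
  -- Completing the square: `½ ‖h‖² + ⟨g, T h⟩ = ½ ‖h + b‖² - ½ ‖b‖²` with `b = T* g`, so the minimiser `h'` of
  -- the translated functional gives `h = h' - b`.
  set b : H := ContinuousLinearMap.adjoint T g with hb
  have hcont : Continuous fun y : H => T (y - b) := by fun_prop
  obtain ⟨h', hfin, hmin⟩ := exists_minimiser (G := fun y => expEnergy μ q (T (y - b)))
    ((lowerSemicontinuous_expEnergy hq).comp hcont)
    (fun x y => by
      have := expEnergy_midpoint_le hq hq0 (T (x - b)) (T (y - b))
      rw [← map_add, ← map_smul] at this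
      convert this using 4
      module)
    ⟨b, by
      have : expEnergy μ q (T (b - b)) = 0 := by
        rw [sub_self, map_zero, expEnergy]
        rw [lintegral_congr_ae (g := fun _ => 0), lintegral_zero]
        filter_upwards [Lp.coeFn_zero ℝ 2 μ] with x hx
        rw [hx]; simp [expGap]
      change expEnergy μ q (T (b - b)) ≠ ⊤
      rw [this]
      exact ENNReal.zero_ne_top⟩
  set h := h' - b with hh
  have hint : Integrable (fun x => q x * expGap (T h x)) μ :=
    integrable_of_expEnergy_ne_top hq hq0 hfin
  refine ⟨h, hint, ?_⟩
  -- One-sided derivatives suffice, since `-v` is also an admissible direction.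
  have key : ∀ (v : H) (S : Set α) (M : ℝ), MeasurableSet S → IntegrableOn q S μ →
        (∀ᵐ x ∂μ, |T v x| ≤ M) → (∀ᵐ x ∂μ, x ∉ S → T v x = 0) →
        0 ≤ inner ℝ h v + inner ℝ g (T v)
          + ∫ x, q x * (Real.exp (2 * T h x) - 1) * T v x ∂μ := by
    intro v S M hSm hS hM hv
    have hexp : IntegrableOn (fun x => q x * Real.exp (2 * T h x)) S μ :=
      integrableOn_mul_exp hq0 (Lp.aestronglyMeasurable _) hint hS
    set e : α → ℝ := S.indicator (fun x => q x * Real.exp (2 * T h x)) with he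
    have he_int : Integrable e μ := hexp.integrable_indicator hSm
    have hfirst : Integrable (fun x => q x * (Real.exp (2 * T h x) - 1) * T v x) μ := by
      refine Integrable.mono' ((he_int.add (hS.integrable_indicator hSm)).const_mul M)
        ((hq.mul ((by fun_prop : Continuous fun s : ℝ => Real.exp (2 * s) - 1).comp_aestronglyMeasurable
          (Lp.aestronglyMeasurable _))).mul (Lp.aestronglyMeasurable _)) ?_
      filter_upwards [hq0, hM, hv] with x hx hMx hvx
      have hx' : 0 ≤ q x := hx
      by_cases hxS : x ∈ S
      · simp only [he, Pi.add_apply, Set.indicator_of_mem hxS]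
        rw [norm_mul, norm_mul, Real.norm_of_nonneg hx', Real.norm_eq_abs, Real.norm_eq_abs]
        have h1 : |Real.exp (2 * T h x) - 1| ≤ Real.exp (2 * T h x) + 1 := by
          rw [abs_le]; constructor <;> linarith [Real.exp_pos (2 * T h x)]
        calc _ ≤ q x * (Real.exp (2 * T h x) + 1) * M := by gcongr
          _ = _ := by ring
      · simp [he, Set.indicator_of_notMem hxS, hvx hxS]
    set I₁ := ∫ x, q x * (Real.exp (2 * T h x) - 1) * T v x ∂μ with hI₁
    set C := ‖v‖ ^ 2 / 2 + ∫ x, 2 * M ^ 2 * Real.exp (2 * M) * e x ∂μ with hC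
    have hineq : ∀ t : ℝ, 0 < t → t ≤ 1 → 0 ≤ inner ℝ h v + inner ℝ g (T v) + I₁ + t * C := by
      intro t ht0 ht1
      have hbound : ∀ᵐ x ∂μ, q x * expGap (T (h + t • v) x) ≤
          q x * expGap (T h x) + t * (q x * (Real.exp (2 * T h x) - 1) * T v x)
            + t ^ 2 * (2 * M ^ 2 * Real.exp (2 * M) * e x) := by
        have e1 : T (h + t • v) = T h + t • T v := by simp
        rw [e1]
        filter_upwards [hq0, hM, hv, Lp.coeFn_add (T h) (t • T v), Lp.coeFn_smul t (T v)]
          with x hx hMx hvx h1 h2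
        have hx' : 0 ≤ q x := hx
        rw [h1, Pi.add_apply, h2, Pi.smul_apply, smul_eq_mul]
        by_cases hxS : x ∈ S
        · have := mul_le_mul_of_nonneg_left (expGap_add_le (T h x) ht0.le ht1 hMx) hx'
          simp only [he, Set.indicator_of_mem hxS]
          linarith
        · simp [he, Set.indicator_of_notMem hxS, hvx hxS]
      have hbint := (hint.add (hfirst.const_mul t)).add
        ((he_int.const_mul (2 * M ^ 2 * Real.exp (2 * M))).const_mul (t ^ 2))
      have hint' : Integrable (fun x => q x * expGap (T (h + t • v) x)) μ := by
        refine Integrable.mono' hbint (aestronglyMeasurable_mul_expGap hq _) ?_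
        filter_upwards [hbound, hq0] with x hx hqx
        rw [Real.norm_of_nonneg (mul_nonneg hqx (expGap_nonneg _))]
        exact hx
      have hfin' : expEnergy μ q (T (h + t • v)) ≠ ⊤ := by
        refine (lintegral_ofReal_ne_top_iff_integrable (aestronglyMeasurable_mul_expGap hq _)
          ?_).2 hint'
        filter_upwards [hq0] with x hx using mul_nonneg hx (expGap_nonneg _)
      have e2 : h' + t • v - b = h + t • v := by rw [hh]; abel
      have hm := hmin (h' + t • v) (by simpa only [e2] using hfin')
      simp only [e2] at hm
      rw [toReal_expEnergy hq hq0, toReal_expEnergy hq hq0] at hm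
      have hle := integral_mono_ae hint' hbint hbound
      rw [integral_add' (hint.add (hfirst.const_mul t)) ((he_int.const_mul _).const_mul _),
        integral_add' hint (hfirst.const_mul t), integral_const_mul, integral_const_mul,
        ← hI₁] at hle
      have hnorm : ‖h' + t • v‖ ^ 2
          = ‖h'‖ ^ 2 + 2 * t * (inner ℝ h v + inner ℝ g (T v)) + t ^ 2 * ‖v‖ ^ 2 := by
        rw [norm_add_sq_real, inner_smul_right, norm_smul, mul_pow, Real.norm_eq_abs, sq_abs,
          show h' = h + b by rw [hh]; abel, inner_add_left, hb,
          ContinuousLinearMap.adjoint_inner_left]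
        ring
      rw [hnorm] at hm
      have : 0 ≤ t * (inner ℝ h v + inner ℝ g (T v) + I₁ + t * C) := by
        rw [hC]; linarith
      exact nonneg_of_mul_nonneg_right this ht0
    have hlim : Tendsto (fun n : ℕ => inner ℝ h v + inner ℝ g (T v) + I₁
        + 1 / ((n : ℝ) + 1) * C) atTop (𝓝 (inner ℝ h v + inner ℝ g (T v) + I₁ + 0 * C)) :=
      tendsto_const_nhds.add (tendsto_one_div_add_atTop_nhds_zero_nat.mul_const C)
    rw [zero_mul, add_zero] at hlim
    refine ge_of_tendsto' hlim fun n => hineq _ (by positivity) ?_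
    rw [div_le_one (by positivity)]
    linarith [n.cast_nonneg (α := ℝ)]
  intro v S M hSm hS hM hv
  have hneg : ∀ᵐ x ∂μ, T (-v) x = -T v x := by
    rw [map_neg]; exact Lp.coeFn_neg (T v)
  have h1 := key v S M hSm hS hM hv
  have h2 := key (-v) S M hSm hS
    (by filter_upwards [hneg, hM] with x hx hMx; rwa [hx, abs_neg])
    (by filter_upwards [hneg, hv] with x hx hvx hxS; rw [hx, hvx hxS, neg_zero])
  have h3 : ∫ x, q x * (Real.exp (2 * T h x) - 1) * T (-v) x ∂μ
      = -∫ x, q x * (Real.exp (2 * T h x) - 1) * T v x ∂μ := by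
    rw [← integral_neg]
    refine integral_congr_ae ?_
    filter_upwards [hneg] with x hx
    rw [hx, mul_neg]
  rw [h3, map_neg, inner_neg_right, inner_neg_right] at h2
  linarith

end EulerLagrange

section Completion

/-- `exists_eulerLagrange` in the completion of a space `V` for a form `a` that dominates the `L²` norm. The
minimiser is described without the completion: as the `L²` limit of a sequence in `V` that is Cauchy for
`a` and whose pairings with `v ∈ V` converge to the value that the equation prescribes. -/
theorem exists_eulerLagrange_of_form {α : Type*} [MeasurableSpace α] {μ : Measure α}
    {V : Type*} [AddCommGroup V] [Module ℝ V] (a : LinearMap.BilinForm ℝ V)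
    (hsymm : ∀ u v, a u v = a v u) (hnonneg : ∀ u, 0 ≤ a u u)
    (T₀ : V →ₗ[ℝ] Lp ℝ 2 μ) {C : ℝ} (hC : 0 ≤ C) (hT₀ : ∀ u, ‖T₀ u‖ ^ 2 ≤ C * a u u)
    (g : Lp ℝ 2 μ) {q : α → ℝ} (hq : AEStronglyMeasurable q μ) (hq0 : 0 ≤ᵐ[μ] q) :
    ∃ (φ : ℕ → V) (u : Lp ℝ 2 μ),
      (∀ ε : ℝ, 0 < ε → ∃ n₀ : ℕ, ∀ m n : ℕ, n₀ ≤ m → n₀ ≤ n →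
        a (φ m - φ n) (φ m - φ n) < ε) ∧
      Tendsto (fun n => T₀ (φ n)) atTop (𝓝 u) ∧
      Integrable (fun x => q x * expGap (u x)) μ ∧
      ∀ (v : V) (S : Set α) (M : ℝ), MeasurableSet S → IntegrableOn q S μ →
        (∀ᵐ x ∂μ, |T₀ v x| ≤ M) → (∀ᵐ x ∂μ, x ∉ S → T₀ v x = 0) →
        Tendsto (fun n => a (φ n) v) atTop (𝓝 (-(inner ℝ g (T₀ v)
          + ∫ x, q x * (Real.exp (2 * u x) - 1) * T₀ v x ∂μ))) := by
  let core : PreInnerProductSpace.Core ℝ V :=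
    { inner := fun u v => a u v
      conj_inner_symm := fun u v => hsymm v u
      re_inner_nonneg := hnonneg
      add_left := fun u v w => by simp
      smul_left := fun u v r => by simp }
  let : SeminormedAddCommGroup V := InnerProductSpace.Core.toSeminormedAddCommGroup (c := core)
  let : InnerProductSpace ℝ V := InnerProductSpace.ofCore core
  have hinner : ∀ u v : V, inner ℝ u v = a u v := fun _ _ => rfl
  have hnorm : ∀ u : V, ‖u‖ ^ 2 = a u u := fun u => by
    rw [← real_inner_self_eq_norm_sq, hinner]
  let T₁ : V →L[ℝ] Lp ℝ 2 μ := T₀.mkContinuous (Real.sqrt C) fun u => by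
    refine abs_le_of_sq_le_sq' ?_ (by positivity) |>.2
    rw [mul_pow, Real.sq_sqrt hC, hnorm]
    exact hT₀ u
  let ι : V →L[ℝ] UniformSpace.Completion V := UniformSpace.Completion.toComplL
  have hdense : DenseRange ι := UniformSpace.Completion.denseRange_coe
  have hui : IsUniformInducing ι := UniformSpace.Completion.isUniformInducing_coe V
  let T : UniformSpace.Completion V →L[ℝ] Lp ℝ 2 μ := T₁.extend ι
  have hT : ∀ v : V, T (ι v) = T₀ v := fun v => T₁.extend_eq hdense hui v
  obtain ⟨h, hint, hEL⟩ := exists_eulerLagrange T g hq hq0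
  obtain ⟨y, hy, hylim⟩ := mem_closure_iff_seq_limit.1 (hdense h)
  choose φ hφy using hy
  have hφ : Tendsto (fun n => ι (φ n)) atTop (𝓝 h) := by simpa only [hφy] using hylim
  refine ⟨φ, T h, fun ε hε => ?_, ?_, hint, fun v S M hSm hS hM hv => ?_⟩
  · obtain ⟨n₀, hn₀⟩ := Metric.cauchySeq_iff.1 hφ.cauchySeq (Real.sqrt ε) (Real.sqrt_pos.2 hε)
    refine ⟨n₀, fun m n hm hn => ?_⟩
    have h1 := hn₀ m hm n hn
    rw [dist_eq_norm, ← map_sub] at h1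
    have h2 : ‖ι (φ m - φ n)‖ = ‖φ m - φ n‖ := UniformSpace.Completion.norm_coe _
    rw [h2, Real.lt_sqrt (norm_nonneg _), hnorm] at h1
    exact h1
  · simpa only [Function.comp_def, hT] using (T.continuous.tendsto h).comp hφ
  · have h1 := hEL (ι v) S M hSm hS (by rwa [hT]) (by rwa [hT])
    rw [hT] at h1
    have h2 : Tendsto (fun n => inner ℝ (ι (φ n)) (ι v)) atTop (𝓝 (inner ℝ h (ι v))) :=
      hφ.inner tendsto_const_nhds
    have h3 : ∀ n, inner ℝ (ι (φ n)) (ι v) = a (φ n) v := fun n =>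
      (UniformSpace.Completion.inner_coe (φ n) v).trans (hinner _ _)
    simp only [h3] at h2
    convert h2 using 2
    linarith

end Completion

variable {N : ℕ}

/-! ### Test functions on the ball -/

section TestFunctions

/-- The factor need only be smooth in the open ball, as is the conformal factor, which is singular on the
unit sphere. -/
lemma IsTest.mul_left {f u : E N → ℝ} (hf : ∀ x ∈ unitBall N, ContDiffAt ℝ ∞ f x)
    (hu : IsTest u) : IsTest (fun x => f x * u x) where
  smooth := contDiff_iff_contDiffAt.2 fun x => by
    by_cases hx : x ∈ tsupport u
    · exact (hf x (hu.subset hx)).mul hu.smooth.contDiffAt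
    · refine (contDiffAt_const (c := (0 : ℝ))).congr_of_eventuallyEq ?_
      filter_upwards [notMem_tsupport_iff_eventuallyEq.1 hx] with y hy
      simp [hy]
  compact := hu.compact.mul_left
  subset := (tsupport_mul_subset_right (f := f)).trans hu.subset

lemma IsTest.mul {u v : E N → ℝ} (hu : IsTest u) (hv : IsTest v) :
    IsTest (fun x => u x * v x) :=
  hv.mul_left fun _ _ => hu.smooth.contDiffAt

lemma IsTest.zero : IsTest (0 : E N → ℝ) where
  smooth := contDiff_const
  compact := HasCompactSupport.zero
  subset := by simp [tsupport]

lemma IsTest.add {u v : E N → ℝ} (hu : IsTest u) (hv : IsTest v) : IsTest (u + v) where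
  smooth := hu.smooth.add hv.smooth
  compact := hu.compact.add hv.compact
  subset := (tsupport_add u v).trans (Set.union_subset hu.subset hv.subset)

lemma IsTest.const_smul {u : E N → ℝ} (c : ℝ) (hu : IsTest u) : IsTest (c • u) :=
  hu.mul_left (f := fun _ => c) fun _ _ => contDiffAt_const

lemma IsTest.sum {ι : Type*} (s : Finset ι) {f : ι → E N → ℝ} (hf : ∀ i ∈ s, IsTest (f i)) :
    IsTest (fun x => ∑ i ∈ s, f i x) := by
  classical
  induction s using Finset.induction_on with
  | empty => exact IsTest.zero
  | insert a s ha ih =>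
    simp only [Finset.sum_insert ha]
    exact (hf a (Finset.mem_insert_self a s)).add
      (ih fun i hi => hf i (Finset.mem_insert_of_mem hi))

lemma IsTest.differentiableAt {u : E N → ℝ} (hu : IsTest u) (x : E N) : DifferentiableAt ℝ u x :=
  (hu.smooth.differentiable (by simp)).differentiableAt

lemma IsTest.eq_zero {u : E N → ℝ} (hu : IsTest u) {x : E N} (hx : x ∉ unitBall N) : u x = 0 :=
  image_eq_zero_of_notMem_tsupport fun h => hx (hu.subset h)

/-- The partial derivative `∂_i u`. -/
noncomputable def partialDeriv (i : Fin N) (u : E N → ℝ) (x : E N) : ℝ :=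
  fderiv ℝ u x (EuclideanSpace.single i 1)

lemma IsTest.partialDeriv {u : E N → ℝ} (hu : IsTest u) (i : Fin N) :
    IsTest (partialDeriv i u) where
  smooth := (hu.smooth.fderiv_right (by simp)).clm_apply contDiff_const
  compact := hu.compact.fderiv_apply (𝕜 := ℝ) _
  subset := (tsupport_fderiv_apply_subset ℝ _).trans hu.subset

lemma partialDeriv_add {u v : E N → ℝ} (hu : IsTest u) (hv : IsTest v) (i : Fin N) :
    partialDeriv i (u + v) = partialDeriv i u + partialDeriv i v := by
  ext x
  simp only [partialDeriv, Pi.add_apply]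
  rw [fderiv_add (hu.differentiableAt x) (hv.differentiableAt x)]
  rfl

lemma partialDeriv_const_smul {u : E N → ℝ} (hu : IsTest u) (c : ℝ) (i : Fin N) :
    partialDeriv i (c • u) = c • partialDeriv i u := by
  ext x
  simp only [partialDeriv, Pi.smul_apply]
  rw [fderiv_const_smul (hu.differentiableAt x)]
  rfl

lemma partialDeriv_mul {u v : E N → ℝ} {x : E N} (hu : DifferentiableAt ℝ u x)
    (hv : DifferentiableAt ℝ v x) (i : Fin N) :
    partialDeriv i (fun y => u y * v y) x = partialDeriv i u x * v x + u x * partialDeriv i v x := by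
  simp only [partialDeriv]
  rw [fderiv_fun_mul hu hv]
  simp only [_root_.add_apply, _root_.smul_apply, smul_eq_mul]
  ring

lemma integral_partialDeriv {u : E N → ℝ} (hu : IsTest u) (i : Fin N) :
    ∫ x, partialDeriv i u x = 0 := by
  have hi : Integrable (partialDeriv i u) :=
    (hu.partialDeriv i).smooth.continuous.integrable_of_hasCompactSupport (hu.partialDeriv i).compact
  have h := integral_mul_fderiv_eq_neg_fderiv_mul_of_integrable (μ := volume)
    (f := fun _ : E N => (1 : ℝ)) (g := u) (v := EuclideanSpace.single i (1 : ℝ)) (by simp)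
    (by simp only [one_mul]; exact hi)
    (by simpa using hu.smooth.continuous.integrable_of_hasCompactSupport hu.compact)
    (fun _ _ => differentiableAt_const _) (fun x _ => hu.differentiableAt x)
  simpa [partialDeriv] using h

end TestFunctions

/-! ### The Laplace-Beltrami operator in coordinates -/

section Coordinates

lemma inner_self_gradient (u : E N → ℝ) (x : E N) :
    inner ℝ x (gradient u x) = ∑ i, x i * partialDeriv i u x := by
  rw [real_inner_comm, inner_gradient_left]
  have h := congrArg (fderiv ℝ u x) ((EuclideanSpace.basisFun (Fin N) ℝ).sum_repr x)
  rw [← h, map_sum]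
  simp [partialDeriv]

lemma norm_gradient_sq (u : E N → ℝ) (x : E N) :
    ‖gradient u x‖ ^ 2 = ∑ i, partialDeriv i u x ^ 2 := by
  rw [EuclideanSpace.real_norm_sq_eq]
  refine Finset.sum_congr rfl fun i _ => ?_
  congr 1
  rw [partialDeriv, ← inner_gradient_left, EuclideanSpace.inner_single_right]
  simp

lemma laplacian_eq_sum {u : E N → ℝ} (hu : IsTest u) (x : E N) :
    Laplacian.laplacian u x = ∑ i, partialDeriv i (partialDeriv i u) x := by
  rw [InnerProductSpace.laplacian_eq_iteratedFDeriv_orthonormalBasis u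
    (EuclideanSpace.basisFun (Fin N) ℝ)]
  refine Finset.sum_congr rfl fun i _ => ?_
  rw [iteratedFDeriv_two_apply]
  have hd : DifferentiableAt ℝ (fderiv ℝ u) x :=
    ((hu.smooth.fderiv_right (m := ∞) (by simp)).differentiable (by simp)).differentiableAt
  unfold partialDeriv
  rw [fderiv_clm_apply hd (differentiableAt_const _)]
  simp

lemma lap_eq_sum {u : E N → ℝ} (hu : IsTest u) (x : E N) :
    lap u x = invFactor x ^ 2 * (∑ i, partialDeriv i (partialDeriv i u) x)
      + ((N : ℝ) - 2) * invFactor x * ∑ i, x i * partialDeriv i u x := by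
  rw [lap, laplacian_eq_sum hu, inner_self_gradient]

lemma contDiff_invFactor : ContDiff ℝ ∞ (invFactor : E N → ℝ) := by
  unfold invFactor
  exact (contDiff_const.sub (contDiff_norm_sq ℝ)).div_const 2

lemma IsTest.lap {u : E N → ℝ} (hu : IsTest u) : IsTest (lap u) := by
  have e : Hyp.lap u = (fun x => invFactor x ^ 2 * (∑ i, Hyp.partialDeriv i (Hyp.partialDeriv i u) x))
      + fun x => (((N : ℝ) - 2) * invFactor x) * ∑ i, x i * Hyp.partialDeriv i u x :=
    funext fun x => lap_eq_sum hu x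
  rw [e]
  refine IsTest.add (IsTest.mul_left (fun x _ => (contDiff_invFactor.pow 2).contDiffAt)
    (IsTest.sum _ fun i _ => (hu.partialDeriv i).partialDeriv i)) (IsTest.mul_left
    (fun x _ => (contDiff_const.mul contDiff_invFactor).contDiffAt) (IsTest.sum _ fun i _ =>
    (hu.partialDeriv i).mul_left (f := fun x => x i) fun x _ => ?_))
  exact (EuclideanSpace.proj (𝕜 := ℝ) i).contDiff.contDiffAt

lemma lap_add {u v : E N → ℝ} (hu : IsTest u) (hv : IsTest v) : lap (u + v) = lap u + lap v := by
  ext x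
  rw [Pi.add_apply, lap_eq_sum (hu.add hv), lap_eq_sum hu, lap_eq_sum hv]
  simp only [partialDeriv_add hu hv, partialDeriv_add (hu.partialDeriv _) (hv.partialDeriv _),
    Pi.add_apply, mul_add, Finset.sum_add_distrib]
  ring

lemma lap_const_smul {u : E N → ℝ} (hu : IsTest u) (c : ℝ) : lap (c • u) = c • lap u := by
  ext x
  rw [Pi.smul_apply, lap_eq_sum (hu.const_smul c), lap_eq_sum hu]
  simp only [partialDeriv_const_smul hu, partialDeriv_const_smul (hu.partialDeriv _),
    Pi.smul_apply, smul_eq_mul, ← Finset.mul_sum, mul_left_comm _ c]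
  ring

end Coordinates

/-! ### The conformal factor -/

section ConformalFactor

/-- The conformal factor `λ = 2 / (1 - |x|²)` of the Poincaré metric, meaningful in the open unit ball. -/
noncomputable def confFactor (x : E N) : ℝ := 2 / (1 - ‖x‖ ^ 2)

lemma one_sub_norm_sq_pos {x : E N} (hx : x ∈ unitBall N) : 0 < 1 - ‖x‖ ^ 2 := by
  rw [unitBall, mem_ball_zero_iff] at hx
  nlinarith [norm_nonneg x]

lemma confFactor_pos {x : E N} (hx : x ∈ unitBall N) : 0 < confFactor x :=
  div_pos two_pos (one_sub_norm_sq_pos hx)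

lemma invFactor_eq_inv (x : E N) : invFactor x = (confFactor x)⁻¹ := by
  rw [invFactor, confFactor, inv_div]

lemma contDiffAt_confFactor {x : E N} (hx : x ∈ unitBall N) :
    ContDiffAt ℝ ∞ (confFactor : E N → ℝ) x :=
  contDiffAt_const.div (contDiff_const.sub (contDiff_norm_sq ℝ)).contDiffAt
    (one_sub_norm_sq_pos hx).ne'

/-- `∂_i λ = λ² x_i`; in this form, with `m + 1` in place of a subtraction, the case `m = 0` is included. -/
lemma partialDeriv_confFactor_pow {x : E N} (hx : x ∈ unitBall N) (m : ℕ) (i : Fin N) :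
    partialDeriv i (fun y => confFactor y ^ m) x = m * confFactor x ^ (m + 1) * x i := by
  have h0 := (one_sub_norm_sq_pos hx).ne'
  have h1 : HasFDerivAt (fun y : E N => 1 - ‖y‖ ^ 2) (-(2 • innerSL ℝ x)) x :=
    (hasStrictFDerivAt_norm_sq x).hasFDerivAt.const_sub 1
  have h2 : HasDerivAt (fun s : ℝ => (2 / s) ^ m)
      (m * (2 / (1 - ‖x‖ ^ 2)) ^ (m - 1) * (-2 / (1 - ‖x‖ ^ 2) ^ 2)) (1 - ‖x‖ ^ 2) := by
    have := ((hasDerivAt_inv h0).const_mul 2).fun_pow m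
    simp only [← div_eq_mul_inv] at this
    refine this.congr_deriv ?_
    ring
  have h3 := h2.comp_hasFDerivAt x h1
  have h4 : fderiv ℝ (fun y : E N => confFactor y ^ m) x = _ := h3.fderiv
  rw [partialDeriv, h4]
  simp only [_root_.smul_apply, _root_.neg_apply, smul_eq_mul,
    innerSL_apply_apply, nsmul_eq_mul, EuclideanSpace.inner_single_right]
  rcases m with _ | m
  · simp
  · simp [confFactor, div_pow]
    field_simp
    ring

lemma partialDeriv_confFactor_pow_mul {u : E N → ℝ} {x : E N} (hx : x ∈ unitBall N)
    (hu : DifferentiableAt ℝ u x) (m : ℕ) (i : Fin N) :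
    partialDeriv i (fun y => confFactor y ^ m * u y) x
      = m * confFactor x ^ (m + 1) * x i * u x + confFactor x ^ m * partialDeriv i u x := by
  rw [partialDeriv_mul (((contDiffAt_confFactor hx).pow m).differentiableAt (by simp)) hu,
    partialDeriv_confFactor_pow hx]

lemma IsTest.confFactor_pow_mul {u : E N → ℝ} (hu : IsTest u) (m : ℕ) :
    IsTest (fun x => confFactor x ^ m * u x) :=
  hu.mul_left fun _ hx => (contDiffAt_confFactor hx).pow m

end ConformalFactor

/-! ### The hyperbolic volume -/

section Volume

lemma measurable_density : Measurable fun x : E N => ((2 / (1 - ‖x‖ ^ 2)) ^ N).toNNReal := by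
  fun_prop

lemma integrable_vol_iff {g : E N → ℝ} :
    Integrable g (vol N) ↔ IntegrableOn (fun x => confFactor x ^ N * g x) (unitBall N) := by
  have : vol N = (volume.restrict (unitBall N)).withDensity
      fun x => (((2 / (1 - ‖x‖ ^ 2)) ^ N).toNNReal : ENNReal) := rfl
  rw [this, integrable_withDensity_iff_integrable_coe_smul measurable_density, IntegrableOn]
  refine integrable_congr ?_
  filter_upwards [ae_restrict_mem measurableSet_ball] with x hx
  exact congrArg (· * g x) (Real.coe_toNNReal _ (pow_pos (confFactor_pos hx) N).le)

lemma integral_vol (g : E N → ℝ) :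
    ∫ x, g x ∂(vol N) = ∫ x in unitBall N, confFactor x ^ N * g x := by
  have : vol N = (volume.restrict (unitBall N)).withDensity
      fun x => (((2 / (1 - ‖x‖ ^ 2)) ^ N).toNNReal : ENNReal) := rfl
  rw [this, integral_withDensity_eq_integral_smul measurable_density]
  refine integral_congr_ae ?_
  filter_upwards [ae_restrict_mem measurableSet_ball] with x hx
  exact congrArg (· * g x) (Real.coe_toNNReal _ (pow_pos (confFactor_pos hx) N).le)

lemma IsTest.integrable_volume {u : E N → ℝ} (hu : IsTest u) : Integrable u :=
  hu.smooth.continuous.integrable_of_hasCompactSupport hu.compact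

lemma IsTest.setIntegral_unitBall {u : E N → ℝ} (hu : IsTest u) :
    ∫ x in unitBall N, u x = ∫ x, u x :=
  setIntegral_eq_integral_of_forall_compl_eq_zero fun _ hx => hu.eq_zero hx

lemma IsTest.integrable {u : E N → ℝ} (hu : IsTest u) : Integrable u (vol N) :=
  integrable_vol_iff.2 (hu.confFactor_pow_mul N).integrable_volume.integrableOn

lemma IsTest.memLp {u : E N → ℝ} (hu : IsTest u) : MemLp u 2 (vol N) := by
  rw [memLp_two_iff_integrable_sq hu.smooth.continuous.aestronglyMeasurable]
  simpa only [pow_two] using (hu.mul hu).integrable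

end Volume

/-! ### Green's formula and the Poincaré inequality -/

section Green

lemma sum_coord_sq (x : E N) : ∑ i, x i ^ 2 = ‖x‖ ^ 2 := (EuclideanSpace.real_norm_sq_eq x).symm

/-- Green's formula: `dv_g = λ^N dx` and `λ^N (Δ_g u) v + λ^{N-2} ⟨∇u, ∇v⟩` is the divergence of
`λ^{N-2} v ∇u`. -/
lemma integral_lap_mul (hN : 2 ≤ N) {u v : E N → ℝ} (hu : IsTest u) (hv : IsTest v) :
    ∫ x, lap u x * v x ∂(vol N)
      = -∫ x in unitBall N, confFactor x ^ (N - 2) * ∑ i, partialDeriv i u x * partialDeriv i v x := by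
  obtain ⟨m, rfl⟩ := Nat.exists_eq_add_of_le' hN
  rw [Nat.add_sub_cancel]
  have hF : ∀ i, IsTest fun x => confFactor x ^ m * (partialDeriv i u x * v x) :=
    fun i => ((hu.partialDeriv i).mul hv).confFactor_pow_mul m
  have hD : IsTest fun x => confFactor x ^ m * ∑ i, partialDeriv i u x * partialDeriv i v x :=
    (IsTest.sum _ fun i _ => (hu.partialDeriv i).mul (hv.partialDeriv i)).confFactor_pow_mul m
  have hS : IsTest fun x => ∑ i, partialDeriv i
      (fun y => confFactor y ^ m * (partialDeriv i u y * v y)) x :=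
    IsTest.sum _ fun i _ => (hF i).partialDeriv i
  have hzero : ∫ x in unitBall (m + 2), ∑ i, partialDeriv i
      (fun y => confFactor y ^ m * (partialDeriv i u y * v y)) x = 0 := by
    rw [hS.setIntegral_unitBall, integral_finsetSum _ fun i _ =>
      ((hF i).partialDeriv i).integrable_volume]
    exact Finset.sum_eq_zero fun i _ => integral_partialDeriv (hF i) i
  rw [integral_vol, ← zero_sub, ← hzero, ← integral_sub hS.integrable_volume.integrableOn
    hD.integrable_volume.integrableOn]
  refine setIntegral_congr_fun measurableSet_ball fun x hx => ?_
  have hl := (confFactor_pos hx).ne'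
  rw [lap_eq_sum hu, invFactor_eq_inv, Finset.mul_sum _ _ (confFactor x ^ m), ← Finset.sum_sub_distrib]
  have e : ∀ i, partialDeriv i (fun y => confFactor y ^ m * (partialDeriv i u y * v y)) x
      - confFactor x ^ m * (partialDeriv i u x * partialDeriv i v x)
      = confFactor x ^ m * v x * partialDeriv i (partialDeriv i u) x
        + m * confFactor x ^ (m + 1) * v x * (x i * partialDeriv i u x) := by
    intro i
    rw [partialDeriv_confFactor_pow_mul hx (((hu.partialDeriv i).mul hv).differentiableAt x),
      partialDeriv_mul ((hu.partialDeriv i).differentiableAt x) (hv.differentiableAt x)]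
    ring
  simp only [e, Finset.sum_add_distrib, ← Finset.mul_sum]
  push_cast
  field_simp
  ring

/-- The Poincaré inequality `∫ |∇_g u|² dv_g ≥ (N - 1)² / 4 ∫ u² dv_g`. With the ground state
`φ = (1 - |x|²)^{(N-1)/2}`, for which `∇ log φ = -(N - 1) / 2 λ x`, integrate
`λ^{N-2} |∇u - u ∇ log φ|² ≥ 0` and remove the mixed term by the divergence of `λ^{N-1} u² x`. -/
lemma poincare (hN : 2 ≤ N) {u : E N → ℝ} (hu : IsTest u) :
    ((N : ℝ) - 1) ^ 2 / 4 * ∫ x, u x * u x ∂(vol N)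
      ≤ ∫ x in unitBall N, confFactor x ^ (N - 2) * ∑ i, partialDeriv i u x * partialDeriv i u x := by
  obtain ⟨m, rfl⟩ := Nat.exists_eq_add_of_le' hN
  rw [Nat.add_sub_cancel]
  have hcoord : ∀ (i : Fin (m + 2)) (x : E (m + 2)), ContDiffAt ℝ ∞ (fun y : E (m + 2) => y i) x :=
    fun i x => (EuclideanSpace.proj (𝕜 := ℝ) i).contDiff.contDiffAt
  have hxu : ∀ i : Fin (m + 2), IsTest fun x : E (m + 2) => x i * (u x * u x) :=
    fun i => (hu.mul hu).mul_left fun x _ => hcoord i x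
  have hF : ∀ i : Fin (m + 2), IsTest fun x => confFactor x ^ (m + 1) * (x i * (u x * u x)) :=
    fun i => (hxu i).confFactor_pow_mul (m + 1)
  have hD : IsTest fun x => confFactor x ^ m * ∑ i, partialDeriv i u x * partialDeriv i u x :=
    (IsTest.sum _ fun i _ => (hu.partialDeriv i).mul (hu.partialDeriv i)).confFactor_pow_mul m
  have hS : IsTest fun x => ∑ i, partialDeriv i
      (fun y => confFactor y ^ (m + 1) * (y i * (u y * u y))) x :=
    IsTest.sum _ fun i _ => (hF i).partialDeriv i
  have hzero : ∫ x in unitBall (m + 2), ∑ i, partialDeriv i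
      (fun y => confFactor y ^ (m + 1) * (y i * (u y * u y))) x = 0 := by
    rw [hS.setIntegral_unitBall, integral_finsetSum _ fun i _ =>
      ((hF i).partialDeriv i).integrable_volume]
    exact Finset.sum_eq_zero fun i _ => integral_partialDeriv (hF i) i
  set c : ℝ := ((m : ℝ) + 1) / 2 with hc
  have hsum : ∫ x in unitBall (m + 2), (confFactor x ^ m * (∑ i, partialDeriv i u x * partialDeriv i u x)
      + c * ∑ i, partialDeriv i (fun y => confFactor y ^ (m + 1) * (y i * (u y * u y))) x)
      = ∫ x in unitBall (m + 2), confFactor x ^ m * ∑ i, partialDeriv i u x * partialDeriv i u x := by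
    rw [integral_add hD.integrable_volume.integrableOn
      (hS.integrable_volume.integrableOn.const_mul c), integral_const_mul, hzero, mul_zero, add_zero]
  rw [← hsum, integral_vol, ← integral_const_mul]
  refine setIntegral_mono_on
    (((hu.mul hu).confFactor_pow_mul _).integrable_volume.integrableOn.const_mul _)
    (hD.integrable_volume.integrableOn.add (hS.integrable_volume.integrableOn.const_mul c))
    measurableSet_ball fun x hx => ?_
  have hl := confFactor_pos hx
  have e : ∀ i, partialDeriv i (fun y => confFactor y ^ (m + 1) * (y i * (u y * u y))) x
      = (m + 1) * confFactor x ^ (m + 2) * (u x) ^ 2 * x i ^ 2 + confFactor x ^ (m + 1) * u x ^ 2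
        + 2 * confFactor x ^ (m + 1) * u x * (x i * partialDeriv i u x) := by
    intro i
    have hpx : partialDeriv i (fun y : E (m + 2) => y i) x = 1 := by
      rw [partialDeriv, show (fun y : E (m + 2) => y i) = EuclideanSpace.proj (𝕜 := ℝ) i from rfl,
        ContinuousLinearMap.fderiv]
      simp
    rw [partialDeriv_confFactor_pow_mul hx ((hxu i).differentiableAt x),
      partialDeriv_mul ((hcoord i x).differentiableAt (by simp)) ((hu.mul hu).differentiableAt x),
      partialDeriv_mul (hu.differentiableAt x) (hu.differentiableAt x), hpx]
    push_cast
    ring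
  simp only [e, Finset.sum_add_distrib, ← Finset.mul_sum, sum_coord_sq]
  -- The square `|∇u - u ∇ log φ|²` for the ground state `φ = (1 - |x|²)^c`.
  have hsq : 0 ≤ confFactor x ^ m * ∑ i, (partialDeriv i u x + c * confFactor x * u x * x i) ^ 2 :=
    mul_nonneg (pow_pos hl m).le (Finset.sum_nonneg fun i _ => sq_nonneg _)
  have e2 : ∑ i, (partialDeriv i u x + c * confFactor x * u x * x i) ^ 2
      = (∑ i, partialDeriv i u x * partialDeriv i u x)
        + 2 * c * confFactor x * u x * (∑ i, x i * partialDeriv i u x)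
        + (c * confFactor x * u x) ^ 2 * ‖x‖ ^ 2 := by
    rw [← sum_coord_sq, Finset.mul_sum, Finset.mul_sum, ← Finset.sum_add_distrib,
      ← Finset.sum_add_distrib]
    exact Finset.sum_congr rfl fun i _ => by ring
  rw [e2] at hsq
  have hρ : confFactor x ^ (m + 1) = confFactor x ^ (m + 2) * ((1 - ‖x‖ ^ 2) / 2) := by
    have h0 := (one_sub_norm_sq_pos hx).ne'
    rw [pow_succ _ (m + 1), mul_assoc]
    have : confFactor x * ((1 - ‖x‖ ^ 2) / 2) = 1 := by rw [confFactor]; field_simp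
    rw [this, mul_one]
  have hpos : 0 ≤ confFactor x ^ (m + 2) * u x ^ 2 * (1 - ‖x‖ ^ 2) * (m + 1) :=
    mul_nonneg (mul_nonneg (by positivity) (one_sub_norm_sq_pos hx).le) (by positivity)
  simp only [Finset.sum_const, Finset.card_univ, Fintype.card_fin, nsmul_eq_mul]
  push_cast
  set P := ∑ i, partialDeriv i u x * partialDeriv i u x
  set R := ∑ i, x i * partialDeriv i u x
  set l := confFactor x
  have h5 : l ^ m * (P + 2 * c * l * u x * R + (c * l * u x) ^ 2 * ‖x‖ ^ 2)
     = l ^ m * P + 2 * c * l ^ (m + 1) * u x * R + c ^ 2 * l ^ (m + 2) * u x ^ 2 * ‖x‖ ^ 2 := by ring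
  rw [h5] at hsq
  have h6 : l ^ m * P + c * ((m + 1) * l ^ (m + 2) * u x ^ 2 * ‖x‖ ^ 2
      + (m + 2) * (l ^ (m + 1) * u x ^ 2) + 2 * l ^ (m + 1) * u x * R)
      - ((m : ℝ) + 2 - 1) ^ 2 / 4 * (l ^ (m + 2) * (u x * u x))
    = (l ^ m * P + 2 * c * l ^ (m + 1) * u x * R + c ^ 2 * l ^ (m + 2) * u x ^ 2 * ‖x‖ ^ 2)
      + l ^ (m + 2) * u x ^ 2 * (1 - ‖x‖ ^ 2) * (m + 1) / 4 := by
    rw [hρ, hc]; ring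
  linarith

end Green

/-! ### The quadratic form of the GJMS operator -/

section TestSpace

/-- The vector space `C_c^∞(ℍ^N)`. -/
noncomputable def testSpace (N : ℕ) : Submodule ℝ (E N → ℝ) where
  carrier := {u | IsTest u}
  add_mem' := IsTest.add
  zero_mem' := IsTest.zero
  smul_mem' c _ hu := hu.const_smul c

/-- `Δ_g` as an endomorphism of `C_c^∞(ℍ^N)`. -/
noncomputable def lapEnd (N : ℕ) : Module.End ℝ (testSpace N) where
  toFun u := ⟨lap u, IsTest.lap u.2⟩
  map_add' u v := Subtype.ext (lap_add u.2 v.2)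
  map_smul' c u := Subtype.ext (lap_const_smul u.2 c)

/-- `P_1 = -Δ_g - N (N - 2) / 4` as an endomorphism of `C_c^∞(ℍ^N)`; it is `yamabe` for `2 ≤ N`. -/
noncomputable def yamabeEnd (N : ℕ) : Module.End ℝ (testSpace N) :=
  -lapEnd N - ((N : ℝ) * ((N : ℝ) - 2) / 4) • 1

/-- The `L²(dv_g)` inner product on test functions. -/
noncomputable def l2Form (N : ℕ) : LinearMap.BilinForm ℝ (testSpace N) :=
  LinearMap.mk₂ ℝ (fun u v => ∫ x, u.1 x * v.1 x ∂(vol N))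
    (fun u v w => by
      rw [← integral_add (u.2.mul w.2).integrable (v.2.mul w.2).integrable]
      exact integral_congr_ae (Eventually.of_forall fun x => add_mul _ _ _))
    (fun c u v => by
      rw [smul_eq_mul, ← integral_const_mul]
      exact integral_congr_ae (Eventually.of_forall fun x => mul_assoc _ _ _))
    (fun u v w => by
      rw [← integral_add (u.2.mul v.2).integrable (u.2.mul w.2).integrable]
      exact integral_congr_ae (Eventually.of_forall fun x => mul_add _ _ _))
    (fun c u v => by
      rw [smul_eq_mul, ← integral_const_mul]
      exact integral_congr_ae (Eventually.of_forall fun x => mul_left_comm _ _ _))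

lemma l2Form_apply (u v : testSpace N) : l2Form N u v = ∫ x, u.1 x * v.1 x ∂(vol N) := rfl

lemma l2Form_symm (u v : testSpace N) : l2Form N u v = l2Form N v u := by
  simp only [l2Form_apply, mul_comm]

lemma l2Form_self_nonneg (u : testSpace N) : 0 ≤ l2Form N u u :=
  integral_nonneg fun x => mul_self_nonneg (u.1 x)

lemma l2Form_lapEnd (hN : 2 ≤ N) (u v : testSpace N) :
    l2Form N (lapEnd N u) v
      = -∫ x in unitBall N, confFactor x ^ (N - 2)
          * ∑ i, partialDeriv i u.1 x * partialDeriv i v.1 x :=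
  integral_lap_mul hN u.2 v.2

lemma l2Form_lapEnd_symm (hN : 2 ≤ N) (u v : testSpace N) :
    l2Form N (lapEnd N u) v = l2Form N u (lapEnd N v) := by
  rw [l2Form_symm u, l2Form_lapEnd hN, l2Form_lapEnd hN]
  simp only [mul_comm (partialDeriv _ u.1 _)]

lemma l2Form_yamabeEnd_symm (hN : 2 ≤ N) (u v : testSpace N) :
    l2Form N (yamabeEnd N u) v = l2Form N u (yamabeEnd N v) := by
  simp [yamabeEnd, l2Form_lapEnd_symm hN]

/-- The spectral gap of `P_1`: `(N - 1)² / 4 - N (N - 2) / 4 = 1 / 4`. -/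
lemma l2Form_le_yamabeEnd (hN : 2 ≤ N) (u : testSpace N) :
    1 / 4 * l2Form N u u ≤ l2Form N (yamabeEnd N u) u := by
  have h := poincare hN u.2
  rw [← neg_neg (∫ x in unitBall N, _), ← l2Form_lapEnd hN u u, ← l2Form_apply] at h
  simp only [yamabeEnd, LinearMap.sub_apply, LinearMap.neg_apply, LinearMap.smul_apply,
    Module.End.one_apply, map_sub, map_neg, map_smul, smul_eq_mul]
  linarith

lemma coe_yamabeEnd (hN : 2 ≤ N) (u : testSpace N) :
    (yamabeEnd N u : E N → ℝ) = yamabe (u : E N → ℝ) := by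
  have h1 : (N : ℝ) - 1 ≠ 0 := by
    have : (2 : ℝ) ≤ N := by exact_mod_cast hN
    linarith
  ext x
  change -lap u.1 x - ((N : ℝ) * ((N : ℝ) - 2) / 4) * u.1 x = _
  rw [yamabe, scalarCurvature]
  field_simp
  ring

lemma coe_prodShift_yamabeEnd (hN : 2 ≤ N) (k : ℕ) (u : testSpace N) :
    (prodShift (yamabeEnd N) k u : E N → ℝ) = gjms k (u : E N → ℝ) := by
  induction k generalizing u with
  | zero => rfl
  | succ k ih =>
    rw [prodShift, Module.End.mul_apply, ih, gjms]
    congr 1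
    ext x
    rw [← coe_yamabeEnd hN]
    rfl

lemma coe_lapEnd_pow (j : ℕ) (u : testSpace N) :
    ((lapEnd N ^ j) u : E N → ℝ) = lap^[j] (u : E N → ℝ) := by
  induction j generalizing u with
  | zero => rfl
  | succ j ih =>
    rw [pow_succ, Module.End.mul_apply, ih, Function.iterate_succ_apply]
    rfl

/-- `∫ |∇_g^m u|² dv_g = ∫ ((-Δ_g)^m u) u dv_g`, by integrations by parts. -/
lemma integral_gradNormSq (hN : 2 ≤ N) (m : ℕ) (u : testSpace N) :
    ∫ x, gradNormSq m (u : E N → ℝ) x ∂(vol N) = l2Form N (((-lapEnd N) ^ m) u) u := by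
  have hsymm := l2Form_lapEnd_symm hN
  obtain ⟨j, rfl | rfl⟩ := Nat.even_or_odd' m
  · have h1 : ∀ x, gradNormSq (2 * j) (u : E N → ℝ) x
        = ((lapEnd N ^ j) u).1 x * ((lapEnd N ^ j) u).1 x := fun x => by
      rw [gradNormSq, if_pos (even_two_mul j), Nat.mul_div_cancel_left _ two_pos,
        ← coe_lapEnd_pow, pow_two]
    simp only [h1]
    rw [← l2Form_apply, form_neg_pow_two_mul hsymm]
  · set w := (lapEnd N ^ j) u with hw
    have h1 : ∀ x, gradNormSq (2 * j + 1) (u : E N → ℝ) x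
        = invFactor x ^ 2 * ∑ i, partialDeriv i w.1 x * partialDeriv i w.1 x := fun x => by
      rw [gradNormSq, if_neg (by simp), Nat.add_sub_cancel, Nat.mul_div_cancel_left _ two_pos,
        ← coe_lapEnd_pow, norm_gradient_sq]
      simp only [pow_two, hw]
    have h2 : l2Form N (((-lapEnd N) ^ (2 * j + 1)) u) u = -l2Form N (lapEnd N w) w :=
      form_neg_pow_two_mul_add_one hsymm j u
    rw [h2, l2Form_lapEnd hN, neg_neg, integral_vol]
    refine setIntegral_congr_fun measurableSet_ball fun x hx => ?_
    have hl := (confFactor_pos hx).ne'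
    simp only [h1]
    rw [invFactor_eq_inv, ← mul_assoc]
    congr 1
    obtain ⟨n, rfl⟩ := Nat.exists_eq_add_of_le' hN
    rw [Nat.add_sub_cancel]
    field_simp
    ring

lemma l2Form_yamabeEnd_pow_le (hN : 2 ≤ N) (m j : ℕ) (u : testSpace N) :
    l2Form N ((yamabeEnd N ^ m) u) u ≤ 4 ^ j * l2Form N ((yamabeEnd N ^ (m + j)) u) u := by
  have h := form_pow_le l2Form_symm l2Form_self_nonneg (l2Form_yamabeEnd_symm hN)
    (by norm_num) (l2Form_le_yamabeEnd hN) m j u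
  have h4 : (4 : ℝ) ^ j * (1 / 4) ^ j = 1 := by rw [← mul_pow]; norm_num
  have := mul_le_mul_of_nonneg_left h (by positivity : (0 : ℝ) ≤ 4 ^ j)
  rwa [← mul_assoc, h4, one_mul] at this

/-- The quadratic form `∫ u (P_k v) dv_g` of the GJMS operator on test functions. -/
noncomputable def gjmsForm (N k : ℕ) : LinearMap.BilinForm ℝ (testSpace N) :=
  (l2Form N).compl₂ (prodShift (yamabeEnd N) k)

lemma gjmsForm_apply (k : ℕ) (u v : testSpace N) :
    gjmsForm N k u v = l2Form N u (prodShift (yamabeEnd N) k v) := rfl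

lemma gjmsForm_symm (hN : 2 ≤ N) (k : ℕ) (u v : testSpace N) :
    gjmsForm N k u v = gjmsForm N k v u := by
  rw [gjmsForm_apply, gjmsForm_apply, l2Form_symm,
    form_prodShift_symm (l2Form_yamabeEnd_symm hN)]

lemma l2Form_yamabeEnd_pow_le_gjmsForm (hN : 2 ≤ N) (k : ℕ) (u : testSpace N) :
    l2Form N ((yamabeEnd N ^ k) u) u ≤ gjmsForm N k u u := by
  have h := form_pow_le_form_prodShift l2Form_symm l2Form_self_nonneg (l2Form_yamabeEnd_symm hN)
    (by norm_num) (l2Form_le_yamabeEnd hN) k 0 u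
  rwa [zero_add, pow_zero, one_mul, l2Form_symm (prodShift _ _ _)] at h

lemma l2Form_le_gjmsForm (hN : 2 ≤ N) (k : ℕ) (u : testSpace N) :
    l2Form N u u ≤ 4 ^ k * gjmsForm N k u u := by
  have h := l2Form_yamabeEnd_pow_le hN 0 k u
  rw [pow_zero, Module.End.one_apply, zero_add] at h
  exact h.trans (mul_le_mul_of_nonneg_left (l2Form_yamabeEnd_pow_le_gjmsForm hN k u) (by positivity))

lemma gjmsForm_self_nonneg (hN : 2 ≤ N) (k : ℕ) (u : testSpace N) : 0 ≤ gjmsForm N k u u :=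
  (form_pow_nonneg l2Form_symm l2Form_self_nonneg (l2Form_yamabeEnd_symm hN)
    (by norm_num) (l2Form_le_yamabeEnd hN) k u).trans (l2Form_yamabeEnd_pow_le_gjmsForm hN k u)

lemma gradNormSq_nonneg (m : ℕ) (u : E N → ℝ) (x : E N) : 0 ≤ gradNormSq m u x := by
  unfold gradNormSq
  split_ifs <;> positivity

/-- Coercivity: the form of `P_k` controls the `H^k` norm. -/
lemma sq_sobolevNorm_le (hN : 2 ≤ N) (k : ℕ) : ∃ C : ℝ, 0 < C ∧ ∀ u : testSpace N,
    sobolevNorm k (u : E N → ℝ) ^ 2 ≤ C * gjmsForm N k u u := by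
  set c : ℝ := (N : ℝ) * ((N : ℝ) - 2) / 4 with hc
  have hc0 : 0 ≤ c := by
    have : (2 : ℝ) ≤ N := by exact_mod_cast hN
    exact div_nonneg (mul_nonneg (by linarith) (by linarith)) (by norm_num)
  have hL : -lapEnd N = yamabeEnd N + c • 1 := by rw [yamabeEnd]; abel
  refine ⟨∑ m ∈ Finset.range (k + 1), (1 + c / (1 / 4)) ^ m * 4 ^ (k - m),
    Finset.sum_pos (fun m _ => by positivity) (by simp), fun u => ?_⟩
  rw [sobolevNorm, Real.sq_sqrt (Finset.sum_nonneg fun m _ =>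
    integral_nonneg fun x => gradNormSq_nonneg m u.1 x), Finset.sum_mul]
  refine Finset.sum_le_sum fun m hm => ?_
  have hmk : m + (k - m) = k := by
    have := Finset.mem_range.1 hm
    omega
  rw [integral_gradNormSq hN, hL]
  have h1 := form_shift_pow_le l2Form_symm l2Form_self_nonneg (l2Form_yamabeEnd_symm hN)
    (by norm_num) (l2Form_le_yamabeEnd hN) hc0 m 0 u
  rw [pow_zero, one_mul, zero_add] at h1
  have h2 := l2Form_yamabeEnd_pow_le hN m (k - m) u
  rw [hmk] at h2
  have h3 := h2.trans (mul_le_mul_of_nonneg_left (l2Form_yamabeEnd_pow_le_gjmsForm hN k u) (by positivity))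
  calc _ ≤ _ := h1
    _ ≤ (1 + c / (1 / 4)) ^ m * (4 ^ (k - m) * gjmsForm N k u u) :=
      mul_le_mul_of_nonneg_left h3 (by positivity)
    _ = _ := (mul_assoc _ _ _).symm

/-- The map from test functions to `L²(dv_g)`. -/
noncomputable def testToL2 (N : ℕ) : testSpace N →ₗ[ℝ] Lp ℝ 2 (vol N) where
  toFun u := (IsTest.memLp u.2).toLp u.1
  map_add' _ _ := rfl
  map_smul' _ _ := rfl

lemma coeFn_testToL2 (u : testSpace N) : testToL2 N u =ᵐ[vol N] u.1 :=
  MemLp.coeFn_toLp (IsTest.memLp u.2)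

lemma inner_testToL2 (f : Lp ℝ 2 (vol N)) (u : testSpace N) :
    inner ℝ f (testToL2 N u) = ∫ x, f x * u.1 x ∂(vol N) := by
  rw [L2.inner_def]
  refine integral_congr_ae ?_
  filter_upwards [coeFn_testToL2 u] with x hx
  rw [hx, RCLike.inner_apply, conj_trivial, mul_comm]

lemma inner_testToL2_testToL2 (u v : testSpace N) :
    inner ℝ (testToL2 N u) (testToL2 N v) = l2Form N u v := by
  rw [inner_testToL2, l2Form_apply]
  refine integral_congr_ae ?_
  filter_upwards [coeFn_testToL2 u] with x hx
  rw [hx]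

end TestSpace

end Hyp

theorem theorem5p3 (N k : ℕ) (hk : 1 ≤ k) (hN : N = 2 * k)
    (Q₁ Q₂ : Hyp.E N → ℝ)
    (hloc : LocallyIntegrableOn Q₂ (Hyp.unitBall N) (Hyp.vol N))
    (hdiff : MemLp (fun x => Q₁ x - Q₂ x) 2 (Hyp.vol N))
    (hneg : ∀ᵐ x ∂(Hyp.vol N), Q₂ x ≤ 0) :
    ∃ u : Hyp.E N → ℝ, Hyp.MemH k u ∧ Hyp.IsWeakSolution k Q₁ Q₂ u := by
  have hN2 : 2 ≤ N := by omega
  have hball : ∀ᵐ x ∂(Hyp.vol N), x ∈ Hyp.unitBall N :=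
    (withDensity_absolutelyContinuous _ _).ae_le (ae_restrict_mem measurableSet_ball)
  have hQ₂ : AEStronglyMeasurable Q₂ (Hyp.vol N) := by
    have := hloc.aestronglyMeasurable
    rwa [Measure.restrict_eq_self_of_ae_mem hball] at this
  have hcpt : ∀ K ⊆ Hyp.unitBall N, IsCompact K → IntegrableOn Q₂ K (Hyp.vol N) :=
    fun K hK hKc => hloc.integrableOn_compact_subset hK hKc
  have hq : AEStronglyMeasurable (fun x => -Q₂ x) (Hyp.vol N) := hQ₂.neg
  have hq0 : 0 ≤ᵐ[Hyp.vol N] fun x => -Q₂ x := by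
    filter_upwards [hneg] with x hx
    simpa using hx
  obtain ⟨φ, u, hcauchy, hlim, hint, hEL⟩ := Hyp.exists_eulerLagrange_of_form
    (Hyp.gjmsForm N k) (Hyp.gjmsForm_symm hN2 k) (Hyp.gjmsForm_self_nonneg hN2 k)
    (Hyp.testToL2 N) (C := 4 ^ k) (by positivity)
    (fun v => by
      rw [← real_inner_self_eq_norm_sq, Hyp.inner_testToL2_testToL2]
      exact Hyp.l2Form_le_gjmsForm hN2 k v)
    (hdiff.toLp _) hq hq0
  have hexp : ∀ K ⊆ Hyp.unitBall N, IsCompact K →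
      IntegrableOn (fun x => Q₂ x * Real.exp (2 * u x)) K (Hyp.vol N) := fun K hK hKc => by
    have := (Hyp.integrableOn_mul_exp hq0 (Lp.aestronglyMeasurable u) hint (hcpt K hK hKc).neg).neg
    refine this.congr (Eventually.of_forall fun x => ?_)
    simp
  refine ⟨u, ⟨Lp.memLp u, fun n => (φ n).1, fun n => (φ n).2, fun ε hε => ?_, ?_⟩, ?_, ?_⟩
  · obtain ⟨C, hC, hle⟩ := Hyp.sq_sobolevNorm_le hN2 k
    obtain ⟨n₀, hn₀⟩ := hcauchy (ε ^ 2 / C) (by positivity)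
    refine ⟨n₀, fun m n hm hn => ?_⟩
    have h1 := hle (φ m - φ n)
    have h2 := (lt_div_iff₀' hC).1 (hn₀ m n hm hn)
    exact lt_of_pow_lt_pow_left₀ 2 hε.le (h1.trans_lt h2)
  · refine ((Lp.tendsto_Lp_iff_tendsto_eLpNorm' _ _).1 hlim).congr fun n => ?_
    exact eLpNorm_congr_ae ((Hyp.coeFn_testToL2 (φ n)).sub EventuallyEq.rfl)
  · exact (locallyIntegrableOn_iff isOpen_ball.isLocallyClosed).2 hexp
  · intro v hv
    let w : Hyp.testSpace N := ⟨v, hv⟩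
    obtain ⟨M, hM⟩ := hv.compact.exists_bound_of_continuous hv.smooth.continuous
    have hw := Hyp.coeFn_testToL2 w
    have h1 := hEL w (tsupport v) M (isClosed_tsupport v).measurableSet
      (hcpt _ hv.subset hv.compact).neg
      (by filter_upwards [hw] with x hx; rw [hx]; exact hM x)
      (by filter_upwards [hw] with x hx hxS; rw [hx]; exact image_eq_zero_of_notMem_tsupport hxS)
    have h2 : Tendsto (fun n => Hyp.gjmsForm N k (φ n) w) atTop
        (𝓝 (inner ℝ u (Hyp.testToL2 N (Hyp.prodShift (Hyp.yamabeEnd N) k w)))) := by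
      refine (hlim.inner tendsto_const_nhds).congr fun n => ?_
      rw [Hyp.inner_testToL2_testToL2, Hyp.gjmsForm_apply]
    have h3 := tendsto_nhds_unique h2 h1
    rw [Hyp.inner_testToL2, Hyp.coe_prodShift_yamabeEnd hN2, Hyp.inner_testToL2] at h3
    have hmul : ∀ f : Hyp.E N → ℝ, IntegrableOn f (tsupport v) (Hyp.vol N) →
        Integrable (fun x => f x * v x) (Hyp.vol N) := fun f hf => by
      have h4 : IntegrableOn (fun x => f x * v x) (tsupport v) (Hyp.vol N) :=
        Integrable.mul_bdd (c := M) hf hv.smooth.continuous.aestronglyMeasurable (Eventually.of_forall hM)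
      refine (integrableOn_iff_integrable_of_support_subset ?_).1 h4
      exact (Function.support_mul_subset_right _ _).trans (subset_tsupport v)
    have hi1 := hmul _ (hcpt _ hv.subset hv.compact)
    have hi2 := hmul _ (hexp _ hv.subset hv.compact)
    have hi3 : Integrable (fun x => (Q₁ x - Q₂ x) * v x) (Hyp.vol N) :=
      hdiff.integrable_mul (Hyp.IsTest.memLp hv)
    have e1 : ∫ x, (hdiff.toLp _ : Hyp.E N → ℝ) x * v x ∂(Hyp.vol N)
        = ∫ x, (Q₁ x - Q₂ x) * v x ∂(Hyp.vol N) := by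
      refine integral_congr_ae ?_
      filter_upwards [hdiff.coeFn_toLp] with x hx
      rw [hx]
    have e2 : ∫ x, -Q₂ x * (Real.exp (2 * u x) - 1) * Hyp.testToL2 N w x ∂(Hyp.vol N)
        = ∫ x, Q₂ x * v x ∂(Hyp.vol N) - ∫ x, Q₂ x * Real.exp (2 * u x) * v x ∂(Hyp.vol N) := by
      rw [← integral_sub hi1 hi2]
      refine integral_congr_ae ?_
      filter_upwards [hw] with x hx
      rw [hx]
      ring
    have e3 : ∫ x, Q₁ x * v x ∂(Hyp.vol N)
        = ∫ x, (Q₁ x - Q₂ x) * v x ∂(Hyp.vol N) + ∫ x, Q₂ x * v x ∂(Hyp.vol N) := by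
      rw [← integral_add hi3 hi1]
      refine integral_congr_ae (Eventually.of_forall fun x => ?_)
      ring
    rw [e2] at h3
    change _ = -((∫ x, (hdiff.toLp _ : Hyp.E N → ℝ) x * v x ∂(Hyp.vol N)) + _) at h3
    rw [e1] at h3
    rw [e3]
    linarith
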